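/- Let $\lambda\in[0,1]$ and let $(\mathsf Y_i)_{i\ge1}$, $(\mathsf Z_i)_{i\ge1}$ be real-valued stochastic processes on a common probability space. For $n\in\mathbb N$ put $\ell=\lfloor\lambda n\rfloor$ and let $\mathsf x=[\mathsf Y_1\,\dots\,\mathsf Y_{n-\ell}\;\mathsf Z_1\,\dots\,\mathsf Z_\ell]^{\mathsf T}\in\mathbb R^n$. Suppose that, for each $n$, the entries of $\mathsf x$ are independent, the first $n-\ell$ of them with distribution $(1-\rho_1)\mu_{\mathrm d_1}+\rho_1\mu_{\mathrm c_1}$ and the last $\ell$ of them with distribution $(1-\rho_2)\mu_{\mathrm d_2}+\rho_2\mu_{\mathrm c_2}$, where $\rho_1,\rho_2\in[0,1]$, $\mu_{\mathrm d_1},\mu_{\mathrm d_2}$ are discrete probability distributions on $\mathbb R$ and $\mu_{\mathrm c_1},\mu_{\mathrm c_2}$ are probability distributions on $\mathbb R$ that are absolutely continuous with respect to Lebesgue measure. For a nonempty bounded set $\mathcal S\subseteq\mathbb R^n$ let $N_{\mathcal S}(\delta)$ be the least number of open Euclidean balls of radius $\delta$ in $\mathbb R^n$ that cover $\mathcal S$,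 and let $$\underline{\dim}_{\mathrm B}(\mathcal S)=\liminf_{\delta\to0}\frac{\log N_{\mathcal S}(\delta)}{\log(1/\delta)},\qquad \overline{\dim}_{\mathrm B}(\mathcal S)=\limsup_{\delta\to0}\frac{\log N_{\mathcal S}(\delta)}{\log(1/\delta)}.$$ For $\varepsilon\in(0,1)$ let $$\underline R_{\mathrm B}(\varepsilon)=\limsup_{n\to\infty}\,\inf_{\mathcal S}\frac{\underline{\dim}_{\mathrm B}(\mathcal S)}{n},\qquad \overline R_{\mathrm B}(\varepsilon)=\limsup_{n\to\infty}\,\inf_{\mathcal S}\frac{\overline{\dim}_{\mathrm B}(\mathcal S)}{n},$$ the infima being over all nonempty bounded Borel sets $\mathcal S\subseteq\mathbb R^n$ with $\mathbb P[\mathsf x\in\mathcal S]\ge1-\varepsilon$. If the two coincide, their common value is the Minkowski dimension compression rate $R_{\mathrm B}(\varepsilon)$. Let $\varepsilon\in(0,1)$ and $R\ge0$, and for each $n$ put $k=\lfloor Rn\rfloor$. Suppose that there are, for each $n$, matrices $\boldsymbol A\in\mathbb R^{k\times(n-\ell)}$, $\boldsymbol B\in\mathbb R^{k\times\ell}$ and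 a Borel measurable map $g\colon\mathbb R^k\to\mathbb R^{n-\ell}\times\mathbb R^\ell$ such that, for all sufficiently large $n$, $$\mathbb P\big[g([\boldsymbol A\;\,\boldsymbol B]\,\mathsf x)\neq\mathsf x\big]\le\varepsilon .$$ Then $R_{\mathrm B}(\varepsilon)$ exists, i.e. $\underline R_{\mathrm B}(\varepsilon)=\overline R_{\mathrm B}(\varepsilon)$, and $R\ge R_{\mathrm B}(\varepsilon)$. -/

import Mathlib

open MeasureTheory ProbabilityTheory Filter Topology

noncomputable section

namespace SignalSeparation

/-- The covering number of `S ⊆ ℝ^ι`: the least number of open `ℓ²`-balls of radius `δ`, with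
arbitrary centers in `ℝ^ι`, that cover `S`. (The minimum exists for bounded `S` and `δ > 0`.) -/
def coveringNumber {ι : Type*} [Fintype ι] (S : Set (EuclideanSpace ℝ ι)) (δ : ℝ) : ℕ :=
  sInf {m : ℕ | ∃ c : Fin m → EuclideanSpace ℝ ι, S ⊆ ⋃ i : Fin m, Metric.ball (c i) δ}

/-- The lower Minkowski dimension of a nonempty bounded set. -/
def lowerMinkowskiDim {ι : Type*} [Fintype ι] (S : Set (EuclideanSpace ℝ ι)) : EReal :=
  liminf (fun δ : ℝ => ((Real.log (coveringNumber S δ) / Real.log (1 / δ) : ℝ) : EReal)) (𝓝[>] 0)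

/-- The upper Minkowski dimension of a nonempty bounded set. -/
def upperMinkowskiDim {ι : Type*} [Fintype ι] (S : Set (EuclideanSpace ℝ ι)) : EReal :=
  limsup (fun δ : ℝ => ((Real.log (coveringNumber S δ) / Real.log (1 / δ) : ℝ) : EReal)) (𝓝[>] 0)

/-- `ℓ = ⌊λ n⌋`, the number of entries of the source vector that come from the `Z`-process. -/
def zLength (lam : ℝ) (n : ℕ) : ℕ := ⌊lam * n⌋₊

/-- The index set of the source vector of dimension `n`: the first `n - ℓ` coordinates, then the
last `ℓ` coordinates. For `0 ≤ λ ≤ 1` it has exactly `n` elements. -/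
abbrev SourceIndex (lam : ℝ) (n : ℕ) : Type :=
  Fin (n - zLength lam n) ⊕ Fin (zLength lam n)

/-- The concatenated source vector `x = [Y₁ … Y_{n-ℓ} Z₁ … Z_ℓ]ᵀ` (the processes are indexed from
`0` here). -/
def sourceVector {Ω : Type*} (lam : ℝ) (Y Z : ℕ → Ω → ℝ) (n : ℕ) (ω : Ω) :
    SourceIndex lam n → ℝ :=
  Sum.elim (fun i => Y i ω) (fun j => Z j ω)

/-- `S` is an approximate support set of the source vector of dimension `n`: a nonempty bounded
Borel set of `ℝⁿ` with `ℙ[x ∈ S] ≥ 1 - ε`. -/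
def IsApproxSupport {Ω : Type*} [MeasurableSpace Ω] (P : Measure Ω) (lam : ℝ) (Y Z : ℕ → Ω → ℝ)
    (ε : ℝ) (n : ℕ) (S : Set (EuclideanSpace ℝ (SourceIndex lam n))) : Prop :=
  S.Nonempty ∧ Bornology.IsBounded S ∧ MeasurableSet S ∧
    1 - ε ≤ P.real {ω | WithLp.toLp 2 (sourceVector lam Y Z n ω) ∈ S}

/-- The lower Minkowski dimension compression rate. -/
def lowerMinkowskiRate {Ω : Type*} [MeasurableSpace Ω] (P : Measure Ω) (lam : ℝ)
    (Y Z : ℕ → Ω → ℝ) (ε : ℝ) : EReal :=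
  limsup (fun n : ℕ =>
    sInf {a : EReal | ∃ S, IsApproxSupport P lam Y Z ε n S ∧ a = lowerMinkowskiDim S / (n : EReal)})
    atTop

/-- The upper Minkowski dimension compression rate. -/
def upperMinkowskiRate {Ω : Type*} [MeasurableSpace Ω] (P : Measure Ω) (lam : ℝ)
    (Y Z : ℕ → Ω → ℝ) (ε : ℝ) : EReal :=
  limsup (fun n : ℕ =>
    sInf {a : EReal | ∃ S, IsApproxSupport P lam Y Z ε n S ∧ a = upperMinkowskiDim S / (n : EReal)})
    atTop

/-- The Minkowski dimension compression rate `R_B(ε)` exists and equals `r`, that is, the lower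
and the upper rate coincide and their common value is `r`. -/
def IsMinkowskiRate {Ω : Type*} [MeasurableSpace Ω] (P : Measure Ω) (lam : ℝ)
    (Y Z : ℕ → Ω → ℝ) (ε r : ℝ) : Prop :=
  lowerMinkowskiRate P lam Y Z ε = (r : EReal) ∧ upperMinkowskiRate P lam Y Z ε = (r : EReal)

/-- A discrete probability distribution on `ℝ`. -/
def IsDiscreteDistribution (μ : Measure ℝ) : Prop :=
  IsProbabilityMeasure μ ∧ ∃ D : Set ℝ, D.Countable ∧ μ Dᶜ = 0

/-- An absolutely continuous probability distribution on `ℝ`. -/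
def IsAbsContDistribution (μ : Measure ℝ) : Prop :=
  IsProbabilityMeasure μ ∧ μ ≪ volume

/-- The mixture `(1 - ρ) μd + ρ μc`. -/
def mixture (ρ : ℝ) (μd μc : Measure ℝ) : Measure ℝ :=
  ENNReal.ofReal (1 - ρ) • μd + ENNReal.ofReal ρ • μc

/-- The concatenated source vector has a mixed discrete-continuous distribution: for each `n` its
entries are independent, the first `n - ℓ` of them have law `(1 - ρ₁) μd₁ + ρ₁ μc₁`, and the last
`ℓ` of them have law `(1 - ρ₂) μd₂ + ρ₂ μc₂`. -/
structure IsMixedSource {Ω : Type*} [MeasurableSpace Ω] (P : Measure Ω) (lam : ℝ)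
    (Y Z : ℕ → Ω → ℝ) (ρ₁ ρ₂ : ℝ) (μd₁ μc₁ μd₂ μc₂ : Measure ℝ) : Prop where
  rho₁_mem : ρ₁ ∈ Set.Icc (0 : ℝ) 1
  rho₂_mem : ρ₂ ∈ Set.Icc (0 : ℝ) 1
  discrete₁ : IsDiscreteDistribution μd₁
  discrete₂ : IsDiscreteDistribution μd₂
  absCont₁ : IsAbsContDistribution μc₁
  absCont₂ : IsAbsContDistribution μc₂
  indep : ∀ n : ℕ,
    iIndepFun (fun (i : SourceIndex lam n) (ω : Ω) => sourceVector lam Y Z n ω i) P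
  law₁ : ∀ (n : ℕ) (i : Fin (n - zLength lam n)),
    P.map (fun ω => sourceVector lam Y Z n ω (Sum.inl i)) = mixture ρ₁ μd₁ μc₁
  law₂ : ∀ (n : ℕ) (j : Fin (zLength lam n)),
    P.map (fun ω => sourceVector lam Y Z n ω (Sum.inr j)) = mixture ρ₂ μd₂ μc₂

/-- For the measurement matrices `[A B]` (one for each `n`) with `k = ⌊R n⌋` rows there is a
sequence of measurable separators `g` with `ℙ[g([A B] x) ≠ x] ≤ ε` for all sufficiently
large `n`. -/
def MeasurableSeparatorAchieves {Ω : Type*} [MeasurableSpace Ω] (P : Measure Ω) (lam : ℝ)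
    (Y Z : ℕ → Ω → ℝ) (R ε : ℝ)
    (A : ∀ n : ℕ, Matrix (Fin ⌊R * n⌋₊) (Fin (n - zLength lam n)) ℝ)
    (B : ∀ n : ℕ, Matrix (Fin ⌊R * n⌋₊) (Fin (zLength lam n)) ℝ) : Prop :=
  ∃ g : ∀ n : ℕ, (Fin ⌊R * n⌋₊ → ℝ) → (SourceIndex lam n → ℝ),
    (∀ n, Measurable (g n)) ∧
    ∀ᶠ n : ℕ in atTop,
      P.real {ω | g n ((Matrix.fromCols (A n) (B n)).mulVec (sourceVector lam Y Z n ω))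
        ≠ sourceVector lam Y Z n ω} ≤ ε

end SignalSeparation

end

/-! Both rates equal `r = (1 - λ) ρ₁ + λ ρ₂`. Choose countable sets carrying the discrete parts and
count the entries of `x` off these atoms. The mean count is within 1 of `r n`, and by Chebyshev
(`measureReal_offIndices_card_le`) the count is within `η n` of `r n` with probability tending to 1.

Upper bound: vectors with at most `K` entries off the atoms are exhausted by bounded finite unions
of cubes of dimension at most `K`; take `K = ⌊(r + η) n⌋`.

Lower bound: a set of probability at least `1 - ε` contains, with positive probability, vectors with
at least `(r - η) n` entries off the atoms. Fixing the atomic entries leaves countably many slices,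
on which the law is absolutely continuous, so one slice has positive Lebesgue measure
(`exists_slice_volume_ne_zero`). A volume count then bounds the lower dimension
(`card_le_lowerMinkowskiDim`).

Converse: the matrix is injective on the set that the separator recovers. That set has a
positive-measure slice, whose difference set is a neighbourhood of 0 by Steinhaus, so the matrix has
no kernel along the slice directions (`card_le_of_injOn`). Hence `r ≤ R`. -/

namespace SignalSeparation

/-! ### Slices, covering numbers and Minkowski dimension. -/

variable {ι : Type*}

/-- The coordinates of `x` that lie outside the given sets. -/
noncomputable def offIndices [Fintype ι] (D : ι → Set ℝ) (x : ι → ℝ) : Finset ι :=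
  open Classical in Finset.univ.filter fun i => x i ∉ D i

@[simp]
lemma mem_offIndices [Fintype ι] {D : ι → Set ℝ} {x : ι → ℝ} {i : ι} : i ∈ offIndices D x ↔ x i ∉ D i := by
  simp [offIndices]

/-- The vector with entries `y i` for `i ∈ I` and `d i` for `i ∉ I`. -/
def glue [DecidableEq ι] (I : Finset ι) (d : ι → ℝ) (y : I → ℝ) (i : ι) : ℝ :=
  if h : i ∈ I then y ⟨i, h⟩ else d i

lemma measurable_glue [DecidableEq ι] (I : Finset ι) (d : ι → ℝ) : Measurable (glue I d) := by
  refine measurable_pi_lambda _ fun i => ?_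
  by_cases h : i ∈ I
  · simpa [glue, h] using measurable_pi_apply _
  · simp [glue, h]

variable [Fintype ι]

lemma exists_cover_of_isBounded {S : Set (EuclideanSpace ℝ ι)} (hS : Bornology.IsBounded S)
    {δ : ℝ} (hδ : 0 < δ) :
    ∃ c : Fin (coveringNumber S δ) → EuclideanSpace ℝ ι, S ⊆ ⋃ i, Metric.ball (c i) δ := by
  have hne : {m : ℕ | ∃ c : Fin m → EuclideanSpace ℝ ι, S ⊆ ⋃ i : Fin m, Metric.ball (c i) δ}
      |>.Nonempty := by
    obtain ⟨t, ht, hc⟩ := Metric.totallyBounded_iff.1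
      (hS.isCompact_closure.totallyBounded.subset subset_closure) δ hδ
    refine ⟨ht.toFinset.card, fun i => (ht.toFinset.equivFin.symm i : EuclideanSpace ℝ ι), ?_⟩
    intro x hx
    obtain ⟨y, hy, hxy⟩ := Set.mem_iUnion₂.1 (hc hx)
    exact Set.mem_iUnion.2 ⟨ht.toFinset.equivFin ⟨y, ht.mem_toFinset.2 hy⟩, by simpa using hxy⟩
  exact Nat.sInf_mem hne

lemma coveringNumber_le_card {S : Set (EuclideanSpace ℝ ι)} {δ : ℝ} (T : Finset (ι → ℝ))
    (h : ∀ x ∈ S, ∃ c ∈ T, x ∈ Metric.ball (WithLp.toLp 2 c) δ) :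
    coveringNumber S δ ≤ T.card := by
  refine Nat.sInf_le ⟨fun i => WithLp.toLp 2 (T.equivFin.symm i : ι → ℝ), fun x hx => ?_⟩
  obtain ⟨c, hc, hxc⟩ := h x hx
  exact Set.mem_iUnion.2 ⟨T.equivFin ⟨c, hc⟩, by simpa using hxc⟩

/-- Restricting coordinates to `I` does not increase distances, so each Euclidean ball of a cover
meets the slice inside a sup-norm ball, which is a cube of volume `(2 * δ) ^ I.card`. -/
lemma volume_slice_le [DecidableEq ι] {S : Set (EuclideanSpace ℝ ι)} (hS : Bornology.IsBounded S)
    (I : Finset ι) (d : ι → ℝ) {δ : ℝ} (hδ : 0 < δ) :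
    volume {y : I → ℝ | WithLp.toLp 2 (glue I d y) ∈ S} ≤
      coveringNumber S δ * ENNReal.ofReal ((2 * δ) ^ I.card) := by
  obtain ⟨c, hc⟩ := exists_cover_of_isBounded hS hδ
  calc volume {y : I → ℝ | WithLp.toLp 2 (glue I d y) ∈ S}
      ≤ volume (⋃ j, Metric.ball (fun i : I => c j i) δ) := by
        refine measure_mono fun y hy => ?_
        obtain ⟨j, hj⟩ := Set.mem_iUnion.1 (hc hy)
        refine Set.mem_iUnion.2 ⟨j, (dist_pi_lt_iff hδ).2 fun i => ?_⟩
        have h1 : dist (glue I d y i) (c j i) ≤ dist (WithLp.toLp 2 (glue I d y)) (c j) := by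
          rw [EuclideanSpace.dist_eq]
          refine Real.le_sqrt_of_sq_le ?_
          exact Finset.single_le_sum
            (f := fun i => dist (glue I d y i) (c j i) ^ 2) (fun _ _ => sq_nonneg _)
            (Finset.mem_univ (i : ι))
        have h2 : glue I d y i = y i := by simp [glue]
        rw [← h2]
        exact h1.trans_lt hj
    _ ≤ ∑ j, volume (Metric.ball (fun i : I => c j i) δ) := measure_iUnion_fintype_le _ _
    _ = _ := by simp [Real.volume_pi_ball _ hδ]

/-- Constant factors in covering numbers contribute `c / log (1 / δ)`, which vanishes; only the
exponent `k` survives. -/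
lemma tendsto_const_div_log_add (c k : ℝ) :
    Tendsto (fun δ : ℝ => ((c / Real.log (1 / δ) + k : ℝ) : EReal)) (𝓝[>] 0) (𝓝 (k : EReal)) := by
  refine (continuous_coe_real_ereal.tendsto k).comp ?_
  have h1 : Tendsto (fun δ : ℝ => Real.log (1 / δ)) (𝓝[>] 0) atTop := by
    simp only [one_div]
    exact Real.tendsto_log_atTop.comp tendsto_inv_nhdsGT_zero
  simpa using (h1.const_div_atTop c).add_const k

lemma eventually_mem_Ioo_zero_one : ∀ᶠ δ : ℝ in 𝓝[>] 0, δ ∈ Set.Ioo (0 : ℝ) 1 :=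
  Ioo_mem_nhdsGT one_pos

/-- A slice of positive Lebesgue measure bounds the lower Minkowski dimension from below. -/
lemma card_le_lowerMinkowskiDim [DecidableEq ι] {S : Set (EuclideanSpace ℝ ι)}
    (hS : Bornology.IsBounded S) (I : Finset ι) (d : ι → ℝ)
    (hpos : volume {y : I → ℝ | WithLp.toLp 2 (glue I d y) ∈ S} ≠ 0) :
    ((I.card : ℝ) : EReal) ≤ lowerMinkowskiDim S := by
  set V := volume {y : I → ℝ | WithLp.toLp 2 (glue I d y) ∈ S} with hV
  have hVtop : V ≠ ⊤ := by
    refine ne_top_of_le_ne_top ?_ (volume_slice_le hS I d one_pos)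
    exact ENNReal.mul_ne_top (ENNReal.natCast_ne_top _) ENNReal.ofReal_ne_top
  have hv : 0 < V.toReal := ENNReal.toReal_pos hpos hVtop
  -- The constant comes from taking logarithms in `V ≤ N(δ) (2δ)^|I|`.
  rw [← (tendsto_const_div_log_add (Real.log V.toReal - I.card * Real.log 2) I.card).liminf_eq]
  refine liminf_le_liminf ?_
  filter_upwards [eventually_mem_Ioo_zero_one] with δ hδ
  have hlog : 0 < Real.log (1 / δ) := Real.log_pos (one_lt_one_div hδ.1 hδ.2)
  rw [EReal.coe_le_coe_iff, div_add' _ _ _ hlog.ne', div_le_div_iff_of_pos_right hlog]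
  have h1 : V.toReal ≤ coveringNumber S δ * (2 * δ) ^ I.card := by
    have := ENNReal.toReal_mono (ENNReal.mul_ne_top (ENNReal.natCast_ne_top _)
      ENNReal.ofReal_ne_top) (volume_slice_le hS I d hδ.1)
    rwa [ENNReal.toReal_mul, ENNReal.toReal_natCast, ENNReal.toReal_ofReal
      (pow_nonneg (by linarith [hδ.1]) _)] at this
  have hN : (coveringNumber S δ : ℝ) ≠ 0 := by
    rintro h
    rw [h, zero_mul] at h1
    linarith
  have h2 := Real.log_le_log hv h1
  have h2δ : (2 : ℝ) * δ ≠ 0 := by linarith [hδ.1]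
  rw [Real.log_mul hN (pow_ne_zero _ h2δ), Real.log_pow, Real.log_mul two_ne_zero hδ.1.ne'] at h2
  rw [one_div, Real.log_inv]
  linarith

/-- A polynomial bound on the covering numbers bounds the upper Minkowski dimension. -/
lemma upperMinkowskiDim_le {S : Set (EuclideanSpace ℝ ι)} {C : ℝ} (hC : 1 ≤ C) (K : ℕ)
    (h : ∀ δ ∈ Set.Ioo (0 : ℝ) 1, (coveringNumber S δ : ℝ) ≤ C * (1 / δ) ^ K) :
    upperMinkowskiDim S ≤ ((K : ℝ) : EReal) := by
  rw [← (tendsto_const_div_log_add (Real.log C) K).limsup_eq]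
  refine limsup_le_limsup ?_
  filter_upwards [eventually_mem_Ioo_zero_one] with δ hδ
  have h1 : 1 < 1 / δ := one_lt_one_div hδ.1 hδ.2
  have hlog : 0 < Real.log (1 / δ) := Real.log_pos h1
  rw [EReal.coe_le_coe_iff, div_add' _ _ _ hlog.ne', div_le_div_iff_of_pos_right hlog]
  have h2 : Real.log (C * (1 / δ) ^ K) = Real.log C + K * Real.log (1 / δ) := by
    rw [Real.log_mul (by positivity) (pow_ne_zero _ (by positivity)), Real.log_pow]
  -- The zero case uses the convention `log 0 = 0`.
  rcases Nat.eq_zero_or_pos (coveringNumber S δ) with h0 | h0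
  · rw [h0, Nat.cast_zero, Real.log_zero]
    have := Real.log_nonneg hC
    positivity
  · rw [← h2]
    exact Real.log_le_log (by exact_mod_cast h0) (h δ hδ)

/-- The points of the cube `[-M, M]^ι` with at most `K` coordinates outside the finite set `F i`. -/
def finiteUnionOfCubes (F : ι → Finset ℝ) (M : ℝ) (K : ℕ) : Set (EuclideanSpace ℝ ι) :=
  {x | (∀ i, |x i| ≤ M) ∧ (offIndices (fun i => (F i : Set ℝ)) x).card ≤ K}

/-- The multiples of `h` in (a neighbourhood of) the interval `[-M, M]`. -/
noncomputable def realGrid (M h : ℝ) : Finset ℝ :=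
  (Finset.Icc (-(⌈M / h⌉₊ : ℤ)) ⌈M / h⌉₊).image fun j : ℤ => (j : ℝ) * h

lemma card_realGrid_le {M h : ℝ} (hM : 0 ≤ M) (hh : 0 < h) :
    ((realGrid M h).card : ℝ) ≤ 2 * (M / h) + 3 := by
  have h1 : (realGrid M h).card ≤ 2 * ⌈M / h⌉₊ + 1 := by
    refine Finset.card_image_le.trans ?_
    rw [Int.card_Icc]
    omega
  have h2 := Nat.ceil_lt_add_one (div_nonneg hM hh.le)
  have h3 : ((realGrid M h).card : ℝ) ≤ 2 * ⌈M / h⌉₊ + 1 := by exact_mod_cast h1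
  linarith

lemma exists_mem_realGrid {M h x : ℝ} (hh : 0 < h) (hx : |x| ≤ M) :
    ∃ c ∈ realGrid M h, |x - c| ≤ h := by
  refine ⟨⌊x / h⌋ * h, Finset.mem_image.2 ⟨⌊x / h⌋, ?_, rfl⟩, ?_⟩
  · have hle : x / h ≤ M / h := by gcongr; exact (abs_le.1 hx).2
    have hge : -(M / h) ≤ x / h := by rw [← neg_div]; gcongr; exact (abs_le.1 hx).1
    have hceil := Nat.le_ceil (M / h)
    rw [Finset.mem_Icc]
    constructor
    · rw [Int.le_floor]
      push_cast
      linarith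
    · rw [← @Int.cast_le ℝ]
      exact (Int.floor_le _).trans (by push_cast; linarith)
  · have h1 := Int.floor_le (x / h)
    have h2 := Int.lt_floor_add_one (x / h)
    have h3 : x / h * h = x := div_mul_cancel₀ _ hh.ne'
    rw [abs_le]
    constructor <;> nlinarith

/-- For each `I` with at most `K` elements, use a grid of mesh proportional to `δ` on `I` and the
finite sets `F i` elsewhere. Each such product has `O(δ⁻ᴷ)` points, and there are at most `2 ^ card
ι` choices of `I`. -/
lemma upperMinkowskiDim_finiteUnionOfCubes_le [DecidableEq ι] (F : ι → Finset ℝ) {M : ℝ}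
    (hM : 0 ≤ M) (K : ℕ) :
    upperMinkowskiDim (finiteUnionOfCubes F M K) ≤ ((K : ℝ) : EReal) := by
  obtain ⟨n, hn⟩ : ∃ n : ℝ, n = (Fintype.card ι : ℕ) := ⟨_, rfl⟩
  obtain ⟨G, hG⟩ : ∃ G : ℝ, G = 2 * (M * (n + 1)) + 3 := ⟨_, rfl⟩
  -- The `+ 1` keeps every factor at least 1, even for empty `F i`, so one product serves all `I`.
  obtain ⟨a, ha⟩ : ∃ a : ℝ, a = ∏ i, ((F i).card + 1 : ℝ) := ⟨_, rfl⟩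
  have hn0 : 0 ≤ n := hn ▸ Nat.cast_nonneg _
  have hG1 : 1 ≤ G := by nlinarith
  have ha1 : 1 ≤ a := by
    have : 1 ≤ ∏ i, ((F i).card + 1) := Nat.one_le_iff_ne_zero.2 (Finset.prod_ne_zero_iff.2
      fun i _ => Nat.succ_ne_zero _)
    rw [ha]
    exact_mod_cast this
  refine upperMinkowskiDim_le (C := 2 ^ Fintype.card ι * (G ^ K * a)) ?_ K fun δ hδ => ?_
  · exact one_le_mul_of_one_le_of_one_le (one_le_pow₀ one_le_two)
      (one_le_mul_of_one_le_of_one_le (one_le_pow₀ hG1) ha1)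
  have hδ1 := hδ.1
  -- A coordinatewise error `h` gives Euclidean error at most `√n * h`, which is below `δ`.
  obtain ⟨h, hh⟩ : ∃ h : ℝ, h = δ / (n + 1) := ⟨_, rfl⟩
  have hh0 : 0 < h := by rw [hh]; positivity
  let P : Finset ι → Finset (ι → ℝ) := fun I =>
    Fintype.piFinset fun i => if i ∈ I then realGrid M h else F i
  let T : Finset (ι → ℝ) := (Finset.univ.filter fun I : Finset ι => I.card ≤ K).biUnion P
  have hGδ : 1 ≤ G * (1 / δ) := one_le_mul_of_one_le_of_one_le hG1 (one_lt_one_div hδ.1 hδ.2).le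
  have hgrid : ((realGrid M h).card : ℝ) ≤ G * (1 / δ) := by
    refine (card_realGrid_le hM hh0).trans ?_
    have : 3 ≤ 3 * (1 / δ) := by nlinarith [one_lt_one_div hδ.1 hδ.2]
    have h2 : M / h = M * (n + 1) * (1 / δ) := by rw [hh]; field_simp
    rw [h2, hG]
    linarith
  have hP : ∀ I : Finset ι, I.card ≤ K → ((P I).card : ℝ) ≤ (G * (1 / δ)) ^ K * a := by
    intro I hI
    rw [Fintype.card_piFinset, Nat.cast_prod]
    calc ∏ i, (((if i ∈ I then realGrid M h else F i).card : ℕ) : ℝ)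
        ≤ ∏ i, ((if i ∈ I then G * (1 / δ) else 1) * ((F i).card + 1 : ℝ)) := by
          refine Finset.prod_le_prod (fun _ _ => Nat.cast_nonneg _) fun i _ => ?_
          split_ifs
          · exact hgrid.trans (le_mul_of_one_le_right (by linarith) (by simp))
          · simp
      _ = (G * (1 / δ)) ^ I.card * a := by
          rw [Finset.prod_mul_distrib, ha, Finset.prod_ite_mem, Finset.univ_inter,
            Finset.prod_const]
      _ ≤ _ := by gcongr
  have hT : (T.card : ℝ) ≤ 2 ^ Fintype.card ι * ((G * (1 / δ)) ^ K * a) := by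
    calc (T.card : ℝ)
        ≤ ∑ I ∈ Finset.univ.filter (fun I : Finset ι => I.card ≤ K), ((P I).card : ℝ) := by
          exact_mod_cast Finset.card_biUnion_le
      _ ≤ ∑ I ∈ Finset.univ.filter (fun I : Finset ι => I.card ≤ K), (G * (1 / δ)) ^ K * a :=
          Finset.sum_le_sum fun I hI => hP I (Finset.mem_filter.1 hI).2
      _ ≤ _ := by
          rw [Finset.sum_const, nsmul_eq_mul]
          refine mul_le_mul_of_nonneg_right ?_ (by positivity)
          have : (Finset.univ.filter (fun I : Finset ι => I.card ≤ K)).card ≤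
              2 ^ Fintype.card ι := by
            refine (Finset.card_filter_le _ _).trans ?_
            rw [Finset.card_univ, Fintype.card_finset]
          exact_mod_cast this
  have hcov : coveringNumber (finiteUnionOfCubes F M K) δ ≤ T.card := by
    refine coveringNumber_le_card T fun x hx => ?_
    set I := offIndices (fun i => (F i : Set ℝ)) x with hI
    have hex : ∀ i, ∃ c ∈ (if i ∈ I then realGrid M h else F i), |x i - c| ≤ h := by
      intro i
      by_cases hi : i ∈ I
      · simpa [hi] using exists_mem_realGrid hh0 (hx.1 i)
      · have hi' : x i ∈ F i := by simpa [hI] using hi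
        exact ⟨x i, by simp [hi, hi'], by simpa using hh0.le⟩
    choose c hc hxc using hex
    refine ⟨c, Finset.mem_biUnion.2 ⟨I, Finset.mem_filter.2 ⟨Finset.mem_univ _, hx.2⟩,
      Fintype.mem_piFinset.2 hc⟩, ?_⟩
    rw [Metric.mem_ball, EuclideanSpace.dist_eq, Real.sqrt_lt' hδ1]
    calc ∑ i, dist (x i) (c i) ^ 2 ≤ ∑ _i : ι, h ^ 2 := by
          refine Finset.sum_le_sum fun i _ => ?_
          rw [Real.dist_eq]
          exact pow_le_pow_left₀ (abs_nonneg _) (hxc i) 2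
      _ = n * h ^ 2 := by simp [hn]
      _ < (n + 1) ^ 2 * h ^ 2 := by
          have : 0 < h ^ 2 := by positivity
          exact mul_lt_mul_of_pos_right (by nlinarith) this
      _ = δ ^ 2 := by rw [hh]; field_simp
  calc (coveringNumber (finiteUnionOfCubes F M K) δ : ℝ) ≤ T.card := by exact_mod_cast hcov
    _ ≤ _ := hT
    _ = _ := by rw [mul_pow]; ring

end SignalSeparation

/-! ### Slices of positive measure, concentration, and injective linear maps. -/

namespace SignalSeparation

/-- Splitting off one coordinate reduces the claim to products of two measures. -/
lemma pi_absolutelyContinuous_fin {n : ℕ} (μ ν : Fin n → Measure ℝ) [∀ i, SigmaFinite (μ i)]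
    [∀ i, SigmaFinite (ν i)] (h : ∀ i, μ i ≪ ν i) : Measure.pi μ ≪ Measure.pi ν := by
  induction n with
  | zero => rw [Measure.pi_of_empty μ, Measure.pi_of_empty ν]
  | succ n ih =>
    have hμ := (measurePreserving_piFinSuccAbove μ 0).symm.map_eq
    have hν := (measurePreserving_piFinSuccAbove ν 0).symm.map_eq
    rw [← hμ, ← hν]
    exact (Measure.AbsolutelyContinuous.prod (h 0) (ih _ _ fun i => h _)).map
      (MeasurableEquiv.measurable _)

variable {ι : Type*} [Fintype ι]

lemma pi_absolutelyContinuous (μ ν : ι → Measure ℝ) [∀ i, SigmaFinite (μ i)]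
    [∀ i, SigmaFinite (ν i)] (h : ∀ i, μ i ≪ ν i) : Measure.pi μ ≪ Measure.pi ν := by
  let e := (Fintype.equivFin ι).symm
  rw [← Measure.pi_map_piCongrLeft e μ, ← Measure.pi_map_piCongrLeft e ν]
  exact (pi_absolutelyContinuous_fin _ _ fun i => h _).map (MeasurableEquiv.measurable _)

variable {Ω : Type*} [MeasurableSpace Ω] {P : Measure Ω} [IsProbabilityMeasure P]

/-- If independent `X i` have laws that are absolutely continuous off the countable sets `D i`, and
with positive probability `X ∈ C` has at least `K` coordinates off those sets, then `C` has a slice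
of dimension at least `K` and of positive Lebesgue measure. -/
lemma exists_slice_volume_ne_zero [DecidableEq ι] {X : Ω → ι → ℝ}
    (hX : ∀ i, Measurable fun ω => X ω i) (hind : iIndepFun (fun i ω => X ω i) P)
    {D : ι → Set ℝ} (hD : ∀ i, (D i).Countable)
    (hac : ∀ i, (P.map fun ω => X ω i).restrict (D i)ᶜ ≪ volume)
    {C : Set (ι → ℝ)} {K : ℕ}
    (hpos : P {ω | X ω ∈ C ∧ K ≤ (offIndices D (X ω)).card} ≠ 0) :
    ∃ (I : Finset ι) (d : ι → ℝ), K ≤ I.card ∧ volume {y : I → ℝ | glue I d y ∈ C} ≠ 0 := by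
  by_contra! hcon
  apply hpos
  -- The value 0 fills the coordinates in `I`, which `glue` ignores; thus one countable set of `d`
  -- serves every `I`.
  have hE : (Set.univ.pi fun i => insert 0 (D i)).Countable :=
    Set.countable_univ_pi fun i => (hD i).insert 0
  let B : Finset ι → (ι → ℝ) → Set Ω := fun I d =>
    {ω | (fun i : I => X ω i) ∈ {y : I → ℝ | glue I d y ∈ C} ∩ Set.univ.pi fun i : I => (D i)ᶜ}
  have hsub : {ω | X ω ∈ C ∧ K ≤ (offIndices D (X ω)).card} ⊆
      ⋃ I ∈ {I : Finset ι | K ≤ I.card}, ⋃ d ∈ Set.univ.pi fun i => insert 0 (D i), B I d := by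
    rintro ω ⟨hωC, hωK⟩
    have hg : glue (offIndices D (X ω)) (fun i => if i ∈ offIndices D (X ω) then 0 else X ω i)
        (fun i : offIndices D (X ω) => X ω i) = X ω := by
      funext i
      by_cases hi : i ∈ offIndices D (X ω) <;> simp [glue, hi]
    refine Set.mem_iUnion₂.2 ⟨offIndices D (X ω), hωK, Set.mem_iUnion₂.2
      ⟨fun i => if i ∈ offIndices D (X ω) then 0 else X ω i, fun i _ => ?_, ?_, ?_⟩⟩
    · by_cases hi : X ω i ∈ D i <;> simp [hi]
    · simpa only [Set.mem_ofPred_eq, hg] using hωC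
    · exact fun i _ => mem_offIndices.1 i.2
  refine measure_mono_null hsub ?_
  refine (measure_biUnion_null_iff (Set.to_countable _)).2 fun I hI =>
    (measure_biUnion_null_iff hE).2 fun d _ => ?_
  have hXI : ∀ i : I, AEMeasurable (fun ω => X ω i) P := fun i => (hX i).aemeasurable
  have hlaw := (iIndepFun_iff_map_fun_eq_pi_map hXI).1
    (hind.precomp (g := fun i : I => (i : ι)) Subtype.val_injective)
  have : ∀ i : I, IsProbabilityMeasure (P.map fun ω => X ω i) := fun i =>
    Measure.isProbabilityMeasure_map (hXI i)
  have hDm : MeasurableSet (Set.univ.pi fun i : I => (D i)ᶜ) :=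
    MeasurableSet.univ_pi fun i => (hD i).measurableSet.compl
  have hnull : (Measure.pi fun i : I => (P.map fun ω => X ω i).restrict (D i)ᶜ)
      {y : I → ℝ | glue I d y ∈ C} = 0 :=
    pi_absolutelyContinuous _ (fun _ => volume) (fun i : I => hac i) (hcon I d hI)
  -- `C` need not be measurable: only the restricting set must be, and `le_map_apply` holds for
  -- arbitrary sets.
  rw [← Measure.restrict_pi_pi, Measure.restrict_apply' hDm, ← hlaw] at hnull
  exact le_antisymm ((Measure.le_map_apply (aemeasurable_pi_lambda _ hXI) _).trans hnull.le) zero_le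

/-- Chebyshev's inequality for the number of coordinates off the sets `D i`. -/
lemma measureReal_offIndices_card_le {X : Ω → ι → ℝ}
    (hX : ∀ i, Measurable fun ω => X ω i) (hind : iIndepFun (fun i ω => X ω i) P)
    {D : ι → Set ℝ} (hD : ∀ i, MeasurableSet (D i)) {t : ℝ} (ht : 0 < t) :
    P.real {ω | t ≤ |((offIndices D (X ω)).card : ℝ) - ∑ i, P.real {ω | X ω i ∉ D i}|} ≤
      Fintype.card ι / t ^ 2 := by
  let W : ι → Ω → ℝ := fun i ω => (D i)ᶜ.indicator 1 (X ω i)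
  have hWm : ∀ i, Measurable (W i) := fun i =>
    (measurable_one.indicator (hD i).compl).comp (hX i)
  have hW01 : ∀ i ω, W i ω ∈ Set.Icc (0 : ℝ) 1 := fun i ω => by
    by_cases h : X ω i ∈ D i <;> simp [W, h]
  have hWL : ∀ i, MemLp (W i) 2 P := fun i =>
    memLp_of_bounded (Eventually.of_forall (hW01 i)) (hWm i).aestronglyMeasurable 2
  have hsum : ∀ ω, (∑ i, W i) ω = (offIndices D (X ω)).card := fun ω => by
    classical
    rw [Finset.sum_apply, offIndices, ← Finset.sum_boole]
    refine Finset.sum_congr (by congr) fun i _ => ?_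
    by_cases h : X ω i ∈ D i <;> simp [W, h]
  have hint : ∫ ω, (∑ i, W i) ω ∂P = ∑ i, P.real {ω | X ω i ∉ D i} := by
    simp only [Finset.sum_apply]
    rw [integral_finsetSum _ fun i _ => (hWL i).integrable one_le_two]
    refine Finset.sum_congr rfl fun i _ => ?_
    exact integral_indicator_one (s := (fun ω => X ω i) ⁻¹' (D i)ᶜ) ((hX i) (hD i).compl)
  have hvar : Var[∑ i, W i; P] ≤ Fintype.card ι := by
    rw [IndepFun.variance_sum (fun i _ => hWL i)]
    · calc ∑ i, Var[W i; P] ≤ ∑ _i : ι, (1 : ℝ) := by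
            refine Finset.sum_le_sum fun i _ => ?_
            refine (variance_le_sq_of_bounded (Eventually.of_forall (hW01 i))
              (hWm i).aemeasurable).trans (by norm_num)
        _ = _ := by simp
    · intro i _ j _ hij
      exact (hind.indepFun hij).comp (measurable_one.indicator (hD i).compl)
        (measurable_one.indicator (hD j).compl)
  have hcheb := meas_ge_le_variance_div_sq (memLp_finsetSum' Finset.univ fun i _ => hWL i) ht
  rw [hint] at hcheb
  simp only [hsum] at hcheb
  refine (ENNReal.toReal_mono ENNReal.ofReal_ne_top hcheb).trans ?_
  rw [ENNReal.toReal_ofReal (div_nonneg (variance_nonneg _ _) (sq_nonneg _))]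
  gcongr

/-- A linear map that is injective on a set with a slice of positive Lebesgue measure has at least
as many rows as the dimension of the slice. -/
lemma card_le_of_injOn [DecidableEq ι] {k : ℕ} (H : Matrix (Fin k) ι ℝ) {C : Set (ι → ℝ)}
    (hC : MeasurableSet C) (hinj : Set.InjOn H.mulVec C) (I : Finset ι) (d : ι → ℝ)
    (hpos : volume {y : I → ℝ | glue I d y ∈ C} ≠ 0) : I.card ≤ k := by
  by_contra! hlt
  let L : (I → ℝ) →ₗ[ℝ] (Fin k → ℝ) := (H.submatrix id (Subtype.val : I → ι)).mulVecLin
  have hker : LinearMap.ker L ≠ ⊥ := LinearMap.ker_ne_bot_of_finrank_lt (by simpa using hlt)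
  obtain ⟨v, hv, hv0⟩ := (Submodule.ne_bot_iff _).1 hker
  -- Steinhaus: the differences of slice points contain `t • v` for all small `t`, in particular for
  -- some `t ≠ 0`.
  have hnhds := Measure.sub_mem_nhds_zero_of_addHaar_pos volume {y : I → ℝ | glue I d y ∈ C}
    (measurable_glue I d hC) (pos_iff_ne_zero.2 hpos)
  have htend : Tendsto (fun t : ℝ => t • v) (𝓝[≠] 0) (𝓝 0) := by
    have : Tendsto (fun t : ℝ => t • v) (𝓝 0) (𝓝 ((0 : ℝ) • v)) :=
      (continuous_id.smul continuous_const).tendsto 0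
    rw [zero_smul] at this
    exact this.mono_left nhdsWithin_le_nhds
  obtain ⟨t, ⟨y, hy, z, hz, hyz⟩, ht0⟩ :=
    ((htend.eventually hnhds).and self_mem_nhdsWithin).exists
  -- The two glued vectors agree off `I`, so only the columns in `I` contribute.
  have hdiff : H.mulVec (glue I d y) - H.mulVec (glue I d z) = L (y - z) := by
    rw [← Matrix.mulVec_sub]
    funext j
    simp only [L, Matrix.mulVecLin_apply, Matrix.mulVec, dotProduct, Matrix.submatrix_apply, id]
    rw [Finset.sum_coe_sort_eq_attach, ← Finset.sum_subset (Finset.subset_univ I), ← Finset.sum_attach I]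
    · refine Finset.sum_congr rfl fun i _ => ?_
      simp [glue]
    · intro i _ hi
      simp [glue, hi]
  have hzero : L (y - z) = 0 := by
    change y - z = t • v at hyz
    rw [hyz, map_smul, LinearMap.mem_ker.1 hv, smul_zero]
  have heq := hinj hy hz (sub_eq_zero.1 (hdiff.trans hzero))
  have hyz' : y = z := by
    funext i
    simpa [glue] using congrFun heq i
  have : t • v = 0 := by
    rw [← hyz, hyz']
    exact sub_self z
  exact (smul_ne_zero ht0 hv0) this

end SignalSeparation

/-! ### Exhaustion by bounded finite unions of cubes. -/

namespace SignalSeparation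

section FiniteUnionOfCubes

variable {ι : Type*} [Fintype ι]

lemma isBounded_finiteUnionOfCubes (F : ι → Finset ℝ) (M : ℝ) (K : ℕ) :
    Bornology.IsBounded (finiteUnionOfCubes F M K) := by
  refine isBounded_iff_forall_norm_le.2 ⟨√(∑ _i : ι, M ^ 2), fun x hx => ?_⟩
  rw [EuclideanSpace.norm_eq]
  refine Real.sqrt_le_sqrt (Finset.sum_le_sum fun i _ => ?_)
  exact pow_le_pow_left₀ (norm_nonneg _) (hx.1 i) 2

lemma measurableSet_finiteUnionOfCubes (F : ι → Finset ℝ) (M : ℝ) (K : ℕ) :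
    MeasurableSet (finiteUnionOfCubes F M K) := by
  have heq : finiteUnionOfCubes F M K = (⋂ i, {x | |x i| ≤ M}) ∩
      ⋃ I ∈ {I : Finset ι | I.card ≤ K}, ⋂ i ∈ {i | i ∉ I}, {x | x i ∈ F i} := by
    ext x
    simp only [finiteUnionOfCubes, Set.mem_ofPred_eq, Set.mem_inter_iff, Set.mem_iInter,
      Set.mem_iUnion, exists_prop]
    refine and_congr_right fun _ => ⟨fun h => ⟨_, h, fun i hi => by simpa using hi⟩, ?_⟩
    rintro ⟨I, hI, hxI⟩
    refine (Finset.card_le_card fun i hi => ?_).trans hI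
    by_contra hiI
    exact mem_offIndices.1 hi (hxI i hiI)
  have hm : ∀ i, Measurable fun x : EuclideanSpace ℝ ι => x i := fun i => by fun_prop
  rw [heq]
  refine (MeasurableSet.iInter fun i => ?_).inter
    (MeasurableSet.biUnion (Set.to_countable _) fun I _ =>
      MeasurableSet.biInter (Set.to_countable _) fun i _ => hm i (F i).measurableSet)
  exact measurableSet_le (hm i).abs measurable_const

/-- The cubes spanned by the first `m` points of the ranges of the `f i`, with side lengths
growing with `m`. -/
noncomputable def cubesUpTo [DecidableEq ι] (f : ι → ℕ → ℝ) (K m : ℕ) :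
    Set (EuclideanSpace ℝ ι) :=
  finiteUnionOfCubes (fun i => (Finset.range m).image (f i)) m K

lemma monotone_cubesUpTo [DecidableEq ι] (f : ι → ℕ → ℝ) (K : ℕ) :
    Monotone (cubesUpTo f K) := by
  rintro m m' hm x ⟨hx1, hx2⟩
  refine ⟨fun i => (hx1 i).trans (Nat.cast_le.2 hm), (Finset.card_le_card ?_).trans hx2⟩
  intro i hi
  rw [mem_offIndices] at hi ⊢
  refine fun hmem => hi ?_
  exact Finset.image_subset_image (Finset.range_mono hm) hmem

lemma exists_mem_cubesUpTo [DecidableEq ι] {f : ι → ℕ → ℝ} {K : ℕ} {x : ι → ℝ}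
    (hx : (offIndices (fun i => Set.range (f i)) x).card ≤ K) :
    ∃ m, WithLp.toLp 2 x ∈ cubesUpTo f K m := by
  have h : ∀ i, ∃ j, x i ∈ Set.range (f i) → f i j = x i := fun i => by
    by_cases hi : x i ∈ Set.range (f i)
    · exact ⟨hi.choose, fun _ => hi.choose_spec⟩
    · exact ⟨0, fun h => absurd h hi⟩
  choose j hj using h
  obtain ⟨m, hm⟩ : ∃ m : ℕ, ∀ i, j i < m ∧ |x i| ≤ m := by
    -- The sum dominates each of the finitely many bounds required of `m`.
    refine ⟨∑ i, (j i + 1 + ⌈|x i|⌉₊), fun i => ?_⟩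
    have h1 : j i + 1 + ⌈|x i|⌉₊ ≤ ∑ i, (j i + 1 + ⌈|x i|⌉₊) :=
      Finset.single_le_sum (f := fun i => j i + 1 + ⌈|x i|⌉₊) (fun _ _ => Nat.zero_le _)
        (Finset.mem_univ i)
    refine ⟨by omega, (Nat.le_ceil _).trans ?_⟩
    exact_mod_cast (by omega : ⌈|x i|⌉₊ ≤ ∑ i, (j i + 1 + ⌈|x i|⌉₊))
  refine ⟨m, fun i => (hm i).2, (Finset.card_le_card fun i hi => ?_).trans hx⟩
  rw [mem_offIndices] at hi ⊢
  refine fun hmem => hi ?_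
  exact Finset.mem_coe.2 (Finset.mem_image.2 ⟨j i, Finset.mem_range.2 (hm i).1, hj i hmem⟩)

end FiniteUnionOfCubes

/-! ### The mixed source: its Minkowski rate and the converse for linear measurements. -/

section Source

/-- Enumerating atoms by `ℕ` lets finite initial segments exhaust them in `cubesUpTo`. -/
lemma IsDiscreteDistribution.exists_range {μ : Measure ℝ} (h : IsDiscreteDistribution μ) :
    ∃ f : ℕ → ℝ, μ (Set.range f)ᶜ = 0 := by
  obtain ⟨D, hD, hμ⟩ := h.2
  obtain ⟨f, hf⟩ := (hD.insert 0).exists_eq_range (Set.insert_nonempty 0 D)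
  refine ⟨f, measure_mono_null (Set.compl_subset_compl.2 ?_) hμ⟩
  rw [← hf]
  exact Set.subset_insert 0 D

lemma mixture_restrict_absolutelyContinuous {μd μc : Measure ℝ} {D : Set ℝ}
    (hd : μd Dᶜ = 0) (hc : IsAbsContDistribution μc) (ρ : ℝ) :
    (mixture ρ μd μc).restrict Dᶜ ≪ volume := by
  rw [mixture, Measure.restrict_add, Measure.restrict_smul, Measure.restrict_smul,
    Measure.restrict_eq_zero.2 hd, smul_zero, zero_add]
  exact (Measure.smul_absolutelyContinuous).trans
    (Measure.absolutelyContinuous_of_le Measure.restrict_le_self |>.trans hc.2)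

lemma mixture_real_compl {μd μc : Measure ℝ} {D : Set ℝ} (hD : D.Countable)
    (hd : μd Dᶜ = 0) (hc : IsAbsContDistribution μc) {ρ : ℝ} (hρ : 0 ≤ ρ) :
    (mixture ρ μd μc).real Dᶜ = ρ := by
  have := hc.1
  have h1 : μc Dᶜ = 1 := (prob_compl_eq_one_iff hD.measurableSet).2 (hc.2 (hD.measure_zero volume))
  rw [measureReal_def, mixture, Measure.add_apply, Measure.smul_apply, Measure.smul_apply, hd, h1]
  simp [hρ]

lemma zLength_le {lam : ℝ} (hlam : lam ∈ Set.Icc (0 : ℝ) 1) (n : ℕ) : zLength lam n ≤ n :=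
  Nat.floor_le_of_le (mul_le_of_le_one_left (Nat.cast_nonneg n) hlam.2)

lemma card_sourceIndex {lam : ℝ} (hlam : lam ∈ Set.Icc (0 : ℝ) 1) (n : ℕ) :
    Fintype.card (SourceIndex lam n) = n := by
  simp [Nat.sub_add_cancel (zLength_le hlam n)]

variable {Ω : Type*} [MeasurableSpace Ω]

lemma measurable_sourceVector_apply {lam : ℝ} {Y Z : ℕ → Ω → ℝ} (hY : ∀ i, Measurable (Y i))
    (hZ : ∀ i, Measurable (Z i)) (n : ℕ) (i : SourceIndex lam n) :
    Measurable fun ω => sourceVector lam Y Z n ω i := by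
  cases i
  · exact hY _
  · exact hZ _

variable {P : Measure Ω} {lam : ℝ} {Y Z : ℕ → Ω → ℝ}
  {ρ₁ ρ₂ : ℝ} {μd₁ μc₁ μd₂ μc₂ : Measure ℝ}

/-- The atoms of the discrete parts of a mixed source can be enumerated, coordinate by coordinate,
so that off the atoms the laws of the entries are absolutely continuous, and the expected number of
entries off the atoms is within distance `1` of `((1 - λ) ρ₁ + λ ρ₂) n`. -/
lemma IsMixedSource.exists_atoms (hlam : lam ∈ Set.Icc (0 : ℝ) 1)
    (hY : ∀ i, Measurable (Y i)) (hZ : ∀ i, Measurable (Z i))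
    (hX : IsMixedSource P lam Y Z ρ₁ ρ₂ μd₁ μc₁ μd₂ μc₂) :
    ∃ f : ∀ n, SourceIndex lam n → ℕ → ℝ,
      (∀ n i, (P.map fun ω => sourceVector lam Y Z n ω i).restrict (Set.range (f n i))ᶜ ≪ volume) ∧
      ∀ n, |∑ i, P.real {ω | sourceVector lam Y Z n ω i ∉ Set.range (f n i)} -
        ((1 - lam) * ρ₁ + lam * ρ₂) * n| ≤ 1 := by
  obtain ⟨f₁, hf₁⟩ := hX.discrete₁.exists_range
  obtain ⟨f₂, hf₂⟩ := hX.discrete₂.exists_range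
  refine ⟨fun n => Sum.elim (fun _ => f₁) (fun _ => f₂), fun n i => ?_, fun n => ?_⟩
  · cases i with
    | inl i =>
      rw [hX.law₁ n i]
      exact mixture_restrict_absolutelyContinuous hf₁ hX.absCont₁ ρ₁
    | inr j =>
      rw [hX.law₂ n j]
      exact mixture_restrict_absolutelyContinuous hf₂ hX.absCont₂ ρ₂
  · have h1 : ∀ i : Fin (n - zLength lam n),
        P.real {ω | sourceVector lam Y Z n ω (Sum.inl i) ∉ Set.range f₁} = ρ₁ := fun i => by
      rw [← mixture_real_compl (Set.countable_range f₁) hf₁ hX.absCont₁ hX.rho₁_mem.1,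
        ← hX.law₁ n i, map_measureReal_apply (measurable_sourceVector_apply hY hZ n _)
          (Set.countable_range f₁).measurableSet.compl]
      rfl
    have h2 : ∀ j : Fin (zLength lam n),
        P.real {ω | sourceVector lam Y Z n ω (Sum.inr j) ∉ Set.range f₂} = ρ₂ := fun j => by
      rw [← mixture_real_compl (Set.countable_range f₂) hf₂ hX.absCont₂ hX.rho₂_mem.1,
        ← hX.law₂ n j, map_measureReal_apply (measurable_sourceVector_apply hY hZ n _)
          (Set.countable_range f₂).measurableSet.compl]
      rfl
    simp only [Fintype.sum_sum_type, Sum.elim_inl, Sum.elim_inr, h1, h2, Finset.sum_const,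
      Finset.card_univ, Fintype.card_fin, nsmul_eq_mul]
    rw [Nat.cast_sub (zLength_le hlam n)]
    have hfl : (zLength lam n : ℝ) ≤ lam * n :=
      Nat.floor_le (mul_nonneg hlam.1 (Nat.cast_nonneg n))
    have hfl' : lam * n < zLength lam n + 1 := Nat.lt_floor_add_one _
    -- The deviation is the rounding error of `⌊λ n⌋` times `ρ₁ - ρ₂`, both of absolute value at
    -- most 1.
    have heq : ((n : ℝ) - zLength lam n) * ρ₁ + zLength lam n * ρ₂ -
        ((1 - lam) * ρ₁ + lam * ρ₂) * n = (lam * n - zLength lam n) * (ρ₁ - ρ₂) := by ring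
    have hρ : |ρ₁ - ρ₂| ≤ 1 := abs_sub_le_iff.2
      ⟨by linarith [hX.rho₁_mem.2, hX.rho₂_mem.1], by linarith [hX.rho₂_mem.2, hX.rho₁_mem.1]⟩
    rw [heq, abs_mul]
    exact mul_le_one₀ (abs_le.2 ⟨by linarith, by linarith⟩) (abs_nonneg _) hρ

variable [IsProbabilityMeasure P]

/-- The proportion of entries off the atoms converges in probability. -/
lemma eventually_measureReal_offIndices_lt (hlam : lam ∈ Set.Icc (0 : ℝ) 1)
    (hY : ∀ i, Measurable (Y i)) (hZ : ∀ i, Measurable (Z i))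
    (hX : IsMixedSource P lam Y Z ρ₁ ρ₂ μd₁ μc₁ μd₂ μc₂)
    {f : ∀ n, SourceIndex lam n → ℕ → ℝ} {r : ℝ}
    (hr : ∀ n, |∑ i, P.real {ω | sourceVector lam Y Z n ω i ∉ Set.range (f n i)} - r * n| ≤ 1)
    {η c : ℝ} (hη : 0 < η) (hc : 0 < c) :
    ∀ᶠ n : ℕ in atTop, P.real {ω | η * n ≤
      |((offIndices (fun i => Set.range (f n i)) (sourceVector lam Y Z n ω)).card : ℝ) - r * n|}
        < c := by
  -- Chebyshev at threshold `η n / 2` gives `n / (η n / 2)² = 4 / (η² n)`; the other half of `η n`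
  -- is at least 1 once `n ≥ 2 / η` and absorbs the error in the mean.
  have hlim : Tendsto (fun n : ℕ => 4 / η ^ 2 / (n : ℝ)) atTop (𝓝 0) :=
    tendsto_const_div_atTop_nhds_zero_nat _
  have hlarge : ∀ᶠ n : ℕ in atTop, 2 / η ≤ (n : ℝ) :=
    tendsto_natCast_atTop_atTop.eventually_ge_atTop _
  filter_upwards [hlim.eventually (gt_mem_nhds hc), hlarge, eventually_gt_atTop 0]
    with n hn1 hn2 hn0
  have hn0' : (0 : ℝ) < n := by exact_mod_cast hn0
  have hn2' : 2 ≤ η * n := by rwa [div_le_iff₀' hη] at hn2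
  have hcheb := measureReal_offIndices_card_le (measurable_sourceVector_apply hY hZ n)
    (hX.indep n) (D := fun i => Set.range (f n i))
    (fun i => (Set.countable_range _).measurableSet) (t := η * n / 2) (by positivity)
  rw [card_sourceIndex hlam] at hcheb
  refine lt_of_le_of_lt ((measureReal_mono fun ω hω => ?_).trans hcheb) ?_
  · have h1 := hr n
    have h2 := abs_sub_le
      ((offIndices (fun i => Set.range (f n i)) (sourceVector lam Y Z n ω)).card : ℝ)
      (∑ i, P.real {ω | sourceVector lam Y Z n ω i ∉ Set.range (f n i)}) (r * n)
    have h3 : η * n ≤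
      |((offIndices (fun i => Set.range (f n i)) (sourceVector lam Y Z n ω)).card : ℝ) - r * n| :=
      hω
    change η * n / 2 ≤ _
    linarith
  · convert! hn1 using 1
    field_simp
    norm_num

/-- Sets of non-negligible probability have slices of positive Lebesgue measure whose dimension is
at least `((1 - λ) ρ₁ + λ ρ₂ - η) n`. -/
lemma IsMixedSource.eventually_exists_slice (hlam : lam ∈ Set.Icc (0 : ℝ) 1)
    (hY : ∀ i, Measurable (Y i)) (hZ : ∀ i, Measurable (Z i))
    (hX : IsMixedSource P lam Y Z ρ₁ ρ₂ μd₁ μc₁ μd₂ μc₂)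
    {ε η : ℝ} (hε : ε < 1) (hη : 0 < η) :
    ∀ᶠ n : ℕ in atTop, ∀ C : Set (SourceIndex lam n → ℝ),
      1 - ε ≤ P.real {ω | sourceVector lam Y Z n ω ∈ C} →
      ∃ (I : Finset (SourceIndex lam n)) (d : SourceIndex lam n → ℝ),
        ((1 - lam) * ρ₁ + lam * ρ₂ - η) * n ≤ I.card ∧
          volume {y : I → ℝ | glue I d y ∈ C} ≠ 0 := by
  obtain ⟨f, hac, hr⟩ := hX.exists_atoms hlam hY hZ
  filter_upwards [eventually_measureReal_offIndices_lt hlam hY hZ hX hr hη (sub_pos.2 hε)]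
    with n hn C hC
  have hpos : P {ω | sourceVector lam Y Z n ω ∈ C ∧ ⌈((1 - lam) * ρ₁ + lam * ρ₂ - η) * n⌉₊ ≤
      (offIndices (fun i => Set.range (f n i)) (sourceVector lam Y Z n ω)).card} ≠ 0 := by
    intro h0
    have hcover : {ω | sourceVector lam Y Z n ω ∈ C} ⊆
        {ω | sourceVector lam Y Z n ω ∈ C ∧ ⌈((1 - lam) * ρ₁ + lam * ρ₂ - η) * n⌉₊ ≤
          (offIndices (fun i => Set.range (f n i)) (sourceVector lam Y Z n ω)).card} ∪
        {ω | η * n ≤ |((offIndices (fun i => Set.range (f n i))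
          (sourceVector lam Y Z n ω)).card : ℝ) - ((1 - lam) * ρ₁ + lam * ρ₂) * n|} := by
      intro ω hω
      by_contra hcon
      obtain ⟨hcon1, hcon2⟩ := not_or.1 hcon
      refine hcon1 ⟨hω, Nat.ceil_le.2 ?_⟩
      have := (abs_lt.1 (not_le.1 (show ¬ η * n ≤ |_| from hcon2))).1
      linarith
    have h1 := (measureReal_mono (μ := P) hcover).trans (measureReal_union_le _ _)
    rw [(measureReal_eq_zero_iff).2 h0, zero_add] at h1
    linarith
  obtain ⟨I, d, hI, hvol⟩ := exists_slice_volume_ne_zero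
    (measurable_sourceVector_apply hY hZ n) (hX.indep n)
    (fun i => Set.countable_range (f n i)) (hac n) hpos
  exact ⟨I, d, Nat.ceil_le.1 hI, hvol⟩

/-- There are approximate support sets of upper Minkowski dimension at most
`((1 - λ) ρ₁ + λ ρ₂ + η) n`. -/
lemma IsMixedSource.eventually_exists_isApproxSupport (hlam : lam ∈ Set.Icc (0 : ℝ) 1)
    (hY : ∀ i, Measurable (Y i)) (hZ : ∀ i, Measurable (Z i))
    (hX : IsMixedSource P lam Y Z ρ₁ ρ₂ μd₁ μc₁ μd₂ μc₂)
    {ε η : ℝ} (hε : ε ∈ Set.Ioo (0 : ℝ) 1) (hη : 0 < η) :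
    ∀ᶠ n : ℕ in atTop, ∃ S, IsApproxSupport P lam Y Z ε n S ∧
      upperMinkowskiDim S ≤ (((((1 - lam) * ρ₁ + lam * ρ₂ + η) * n : ℝ)) : EReal) := by
  obtain ⟨f, -, hr⟩ := hX.exists_atoms hlam hY hZ
  filter_upwards [eventually_measureReal_offIndices_lt hlam hY hZ hX hr hη hε.1] with n hn
  obtain ⟨r, hr0⟩ : ∃ r, r = (1 - lam) * ρ₁ + lam * ρ₂ := ⟨_, rfl⟩
  rw [← hr0] at hn ⊢
  have hr_nonneg : 0 ≤ r := by
    rw [hr0]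
    have := hlam.1
    have := sub_nonneg.2 hlam.2
    have := hX.rho₁_mem.1
    have := hX.rho₂_mem.1
    positivity
  set K := ⌊(r + η) * n⌋₊ with hK
  have hKle : (K : ℝ) ≤ (r + η) * n := Nat.floor_le (by positivity)
  let E : ℕ → Set Ω := fun m => {ω | WithLp.toLp 2 (sourceVector lam Y Z n ω) ∈
    cubesUpTo (f n) K m}
  have hE : Monotone E := fun m m' hm ω hω => monotone_cubesUpTo (f n) K hm hω
  -- Strictness matters: by continuity from below, some single `E m` already exceeds `1 - ε`.
  have hunion : 1 - ε < P.real (⋃ m, E m) := by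
    have hcover : (Set.univ : Set Ω) ⊆ (⋃ m, E m) ∪ {ω | η * n ≤
        |((offIndices (fun i => Set.range (f n i)) (sourceVector lam Y Z n ω)).card : ℝ)
          - r * n|} := by
      intro ω _
      by_contra hcon
      obtain ⟨hcon1, hcon2⟩ := not_or.1 hcon
      refine hcon1 (Set.mem_iUnion.2 (exists_mem_cubesUpTo (Nat.le_floor ?_)))
      have := (abs_lt.1 (not_le.1 (show ¬ η * n ≤ |_| from hcon2))).2
      linarith
    have h1 := (measureReal_mono (μ := P) hcover).trans (measureReal_union_le _ _)
    rw [probReal_univ] at h1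
    linarith
  have hlim : Tendsto (fun m => P.real (E m)) atTop (𝓝 (P.real (⋃ m, E m))) :=
    (ENNReal.tendsto_toReal (measure_ne_top P _)).comp (tendsto_measure_iUnion_atTop hE)
  obtain ⟨m, hm⟩ := (hlim.eventually (lt_mem_nhds hunion)).exists
  refine ⟨cubesUpTo (f n) K m, ⟨?_, isBounded_finiteUnionOfCubes _ _ _,
    measurableSet_finiteUnionOfCubes _ _ _, hm.le⟩, ?_⟩
  · have hne : (E m).Nonempty := by
      rw [Set.nonempty_iff_ne_empty]
      rintro h
      rw [h, measureReal_empty] at hm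
      linarith [hε.2]
    obtain ⟨ω, hω⟩ := hne
    exact ⟨_, hω⟩
  · exact (upperMinkowskiDim_finiteUnionOfCubes_le _ (Nat.cast_nonneg m) K).trans
      (EReal.coe_le_coe_iff.2 hKle)

lemma lowerMinkowskiDim_le_upperMinkowskiDim {ι : Type*} [Fintype ι]
    (S : Set (EuclideanSpace ℝ ι)) : lowerMinkowskiDim S ≤ upperMinkowskiDim S :=
  liminf_le_limsup

lemma lowerMinkowskiRate_le_upperMinkowskiRate (P : Measure Ω) (lam : ℝ) (Y Z : ℕ → Ω → ℝ)
    (ε : ℝ) : lowerMinkowskiRate P lam Y Z ε ≤ upperMinkowskiRate P lam Y Z ε := by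
  refine limsup_le_limsup (Eventually.of_forall fun n => le_sInf ?_)
  rintro _ ⟨S, hS, rfl⟩
  have hmem : lowerMinkowskiDim S / (n : EReal) ∈ {a : EReal | ∃ S, IsApproxSupport P lam Y Z ε n S ∧
      a = lowerMinkowskiDim S / (n : EReal)} := ⟨S, hS, rfl⟩
  refine (sInf_le hmem).trans ?_
  exact EReal.div_le_div_right_of_nonneg n.cast_nonneg'
    (lowerMinkowskiDim_le_upperMinkowskiDim S)

lemma ereal_mul_natCast_div (a : ℝ) {n : ℕ} (hn : 0 < n) :
    ((a * n : ℝ) : EReal) / (n : EReal) = (a : EReal) := by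
  have hn' : (n : ℝ) ≠ 0 := by exact_mod_cast hn.ne'
  rw [← EReal.coe_natCast, ← EReal.coe_div, mul_div_cancel_right₀ _ hn']

lemma IsMixedSource.upperMinkowskiRate_le (hlam : lam ∈ Set.Icc (0 : ℝ) 1)
    (hY : ∀ i, Measurable (Y i)) (hZ : ∀ i, Measurable (Z i))
    (hX : IsMixedSource P lam Y Z ρ₁ ρ₂ μd₁ μc₁ μd₂ μc₂) {ε : ℝ} (hε : ε ∈ Set.Ioo (0 : ℝ) 1) :
    upperMinkowskiRate P lam Y Z ε ≤ (((1 - lam) * ρ₁ + lam * ρ₂ : ℝ) : EReal) := by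
  -- It suffices to bound the rate by every real `z` above the target, with `η` the excess of `z`.
  refine EReal.le_of_forall_lt_iff_le.1 fun z hz => ?_
  have hη := sub_pos.2 (EReal.coe_lt_coe_iff.1 hz)
  refine limsup_le_of_le (by isBoundedDefault) ?_
  filter_upwards [hX.eventually_exists_isApproxSupport hlam hY hZ hε hη, eventually_gt_atTop 0]
    with n ⟨S, hS, hdim⟩ hn
  have hmem : upperMinkowskiDim S / (n : EReal) ∈ {a : EReal | ∃ S, IsApproxSupport P lam Y Z ε n S ∧
      a = upperMinkowskiDim S / (n : EReal)} := ⟨S, hS, rfl⟩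
  refine (sInf_le hmem).trans ?_
  refine (EReal.div_le_div_right_of_nonneg n.cast_nonneg' hdim).trans ?_
  rw [ereal_mul_natCast_div _ hn, add_sub_cancel]

lemma IsMixedSource.le_lowerMinkowskiRate (hlam : lam ∈ Set.Icc (0 : ℝ) 1)
    (hY : ∀ i, Measurable (Y i)) (hZ : ∀ i, Measurable (Z i))
    (hX : IsMixedSource P lam Y Z ρ₁ ρ₂ μd₁ μc₁ μd₂ μc₂) {ε : ℝ} (hε : ε < 1) :
    (((1 - lam) * ρ₁ + lam * ρ₂ : ℝ) : EReal) ≤ lowerMinkowskiRate P lam Y Z ε := by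
  refine EReal.ge_of_forall_gt_iff_ge.1 fun z hz => ?_
  have hη := sub_pos.2 (EReal.coe_lt_coe_iff.1 hz)
  refine le_limsup_of_frequently_le (Eventually.frequently ?_) (by isBoundedDefault)
  filter_upwards [hX.eventually_exists_slice hlam hY hZ hε hη, eventually_gt_atTop 0] with n hn hn0
  refine le_sInf ?_
  rintro _ ⟨S, ⟨-, hbdd, -, hP⟩, rfl⟩
  obtain ⟨I, d, hI, hvol⟩ := hn {x | WithLp.toLp 2 x ∈ S} hP
  rw [sub_sub_cancel] at hI
  rw [← ereal_mul_natCast_div z hn0]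
  exact EReal.div_le_div_right_of_nonneg n.cast_nonneg'
    ((EReal.coe_le_coe_iff.2 hI).trans (card_le_lowerMinkowskiDim hbdd I d hvol))

/-- Linear measurements with a measurable separator need rate at least `(1 - λ) ρ₁ + λ ρ₂`. -/
lemma MeasurableSeparatorAchieves.le_rate (hlam : lam ∈ Set.Icc (0 : ℝ) 1)
    (hY : ∀ i, Measurable (Y i)) (hZ : ∀ i, Measurable (Z i))
    (hX : IsMixedSource P lam Y Z ρ₁ ρ₂ μd₁ μc₁ μd₂ μc₂) {ε R : ℝ} (hε : ε < 1) (hR : 0 ≤ R)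
    {A : ∀ n : ℕ, Matrix (Fin ⌊R * n⌋₊) (Fin (n - zLength lam n)) ℝ}
    {B : ∀ n : ℕ, Matrix (Fin ⌊R * n⌋₊) (Fin (zLength lam n)) ℝ}
    (hsep : MeasurableSeparatorAchieves P lam Y Z R ε A B) :
    (1 - lam) * ρ₁ + lam * ρ₂ ≤ R := by
  obtain ⟨g, hg, hgP⟩ := hsep
  by_contra! hlt
  -- Taking `η` as half the gap `r - R` yields a slice of dimension at least `(r + R) / 2 * n`,
  -- still above `R * n`.
  obtain ⟨n, ⟨hn, hn0⟩, hnP⟩ := ((hX.eventually_exists_slice hlam hY hZ hε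
    (half_pos (sub_pos.2 hlt))).and (eventually_gt_atTop 0) |>.and hgP).exists
  let H := Matrix.fromCols (A n) (B n)
  let C : Set (SourceIndex lam n → ℝ) := {x | g n (H.mulVec x) = x}
  have hC : MeasurableSet C :=
    measurableSet_eq_fun ((hg n).comp (Continuous.matrix_mulVec continuous_const
      continuous_id).measurable) measurable_id
  -- On `C` the separator `g n` is a left inverse of `H`.
  have hinj : Set.InjOn H.mulVec C := fun x hx y hy hxy =>
    (Eq.symm hx).trans ((congrArg (g n) hxy).trans hy)
  have hmeas : Measurable fun ω => sourceVector lam Y Z n ω :=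
    measurable_pi_lambda _ (measurable_sourceVector_apply hY hZ n)
  have hprob : 1 - ε ≤ P.real {ω | sourceVector lam Y Z n ω ∈ C} := by
    have h1 := probReal_compl_eq_one_sub (μ := P) (hmeas hC)
    have h2 : P.real ((fun ω => sourceVector lam Y Z n ω) ⁻¹' C)ᶜ ≤ ε := hnP
    change 1 - ε ≤ P.real ((fun ω => sourceVector lam Y Z n ω) ⁻¹' C)
    linarith
  obtain ⟨I, d, hI, hvol⟩ := hn C hprob
  have hIk : (I.card : ℝ) ≤ R * n :=
    (Nat.cast_le.2 (card_le_of_injOn H hC hinj I d hvol)).trans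
      (Nat.floor_le (mul_nonneg hR (Nat.cast_nonneg n)))
  have hn0' : (0 : ℝ) < n := by exact_mod_cast hn0
  nlinarith

end Source

end SignalSeparation

theorem proposition4 {Ω : Type*} [MeasurableSpace Ω] (P : Measure Ω) [IsProbabilityMeasure P]
    (lam : ℝ) (hlam : lam ∈ Set.Icc (0 : ℝ) 1)
    (Y Z : ℕ → Ω → ℝ) (hY : ∀ i, Measurable (Y i)) (hZ : ∀ i, Measurable (Z i))
    (ρ₁ ρ₂ : ℝ) (μd₁ μc₁ μd₂ μc₂ : Measure ℝ)
    (hX : SignalSeparation.IsMixedSource P lam Y Z ρ₁ ρ₂ μd₁ μc₁ μd₂ μc₂)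
    (ε : ℝ) (hε : ε ∈ Set.Ioo (0 : ℝ) 1) (R : ℝ) (hR : 0 ≤ R)
    (hsep : ∃ (A : ∀ n : ℕ, Matrix (Fin ⌊R * n⌋₊) (Fin (n - SignalSeparation.zLength lam n)) ℝ)
        (B : ∀ n : ℕ, Matrix (Fin ⌊R * n⌋₊) (Fin (SignalSeparation.zLength lam n)) ℝ),
      SignalSeparation.MeasurableSeparatorAchieves P lam Y Z R ε A B) :
    ∃ r : ℝ, SignalSeparation.IsMinkowskiRate P lam Y Z ε r ∧ r ≤ R := by
  obtain ⟨A, B, hAB⟩ := hsep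
  have hup := hX.upperMinkowskiRate_le hlam hY hZ hε
  have hlow := hX.le_lowerMinkowskiRate hlam hY hZ hε.2
  have hle := SignalSeparation.lowerMinkowskiRate_le_upperMinkowskiRate P lam Y Z ε
  exact ⟨(1 - lam) * ρ₁ + lam * ρ₂, ⟨le_antisymm (hle.trans hup) hlow,
    le_antisymm hup (hlow.trans hle)⟩, hAB.le_rate hlam hY hZ hX hε.2 hR⟩
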